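/- Let $X$ and $Y$ be compact metric spaces, let $\mu$ and $\nu$ be Borel probability measures on $X$ and $Y$ (they are automatically Radon), let $c : X\times Y\to\mathbb R$ be continuous, and let $\varepsilon\ge 0$. Write $\mathcal C(X),\mathcal C(Y)$ for the spaces of continuous real functions and $\Pi(\mu,\nu)$ for the set of Borel probability measures on $X\times Y$ with marginals $\mu$ and $\nu$. For probability measures $\pi,\xi$ on $X\times Y$ put $$\mathrm{KL}(\pi|\xi)=\int \Big(\log\frac{d\pi}{d\xi}-1\Big)\,d\pi\in(-\infty,+\infty],$$ with $\mathrm{KL}(\pi|\xi)=+\infty$ if $\pi$ has no density with respect to $\xi$. Define $$W_\varepsilon(\mu,\nu)=\inf_{\pi\in\Pi(\mu,\nu)}\int c\,d\pi+\varepsilon\,\mathrm{KL}(\pi|\mu\otimes\nu)\qquad(P_\varepsilon)$$ where $0\cdot(+\infty)=0$. For $u\in\mathcal C(X)$, $v\in\mathcal C(Y)$ let $$F_\varepsilon(u,v)=\int_X u\,d\mu+\int_Y v\,d\nu-\iota^\varepsilon(u,v),$$ where, for $\varepsilon=0$, $\iota^0(u,v)=0$ if $u(x)+v(y)\le c(x,y)$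 for all $(x,y)\in X\times Y$ and $\iota^0(u,v)=+\infty$ otherwise, and, for $\varepsilon>0$, $$\iota^\varepsilon(u,v)=\varepsilon\int_{X\times Y} \exp\Big(\frac{u(x)+v(y)-c(x,y)}{\varepsilon}\Big)\,d\mu(x)\,d\nu(y).$$ For $v\in\mathcal C(Y)$ and $x\in X$ let $$v^{c,0}(x)=\min_{y\in Y}\big(c(x,y)-v(y)\big),\qquad v^{c,\varepsilon}(x)=-\varepsilon\log\int_Y \exp\Big(\frac{v(y)-c(x,y)}{\varepsilon}\Big)\,d\nu(y)\quad(\varepsilon>0),$$ and $$H_\varepsilon(v)=\int_X v^{c,\varepsilon}\,d\mu+\int_Y v\,d\nu-\varepsilon .$$ Then the infimum in $(P_\varepsilon)$ is attained, $v^{c,\varepsilon}\in\mathcal C(X)$ for every $v\in\mathcal C(Y)$, and $$W_\varepsilon(\mu,\nu)=\max_{u\in\mathcal C(X),\,v\in\mathcal C(Y)}F_\varepsilon(u,v)\quad(D_\varepsilon)\qquad\text{and}\qquad W_\varepsilon(\mu,\nu)=\max_{v\in\mathcal C(Y)}H_\varepsilon(v)\quad(S_\varepsilon),$$ both maxima being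 attained. If $v$ solves $(S_\varepsilon)$, then $(v^{c,\varepsilon},v)$ solves $(D_\varepsilon)$; conversely, if $(u,v)$ solves $(D_\varepsilon)$, then $v$ solves $(S_\varepsilon)$ and $u=v^{c,\varepsilon}$ $\mu$-almost everywhere. Finally, if $\varepsilon>0$ and $(u,v)$ is any solution of $(D_\varepsilon)$, then $(P_\varepsilon)$ has exactly one solution $\pi$, and it is given by $$d\pi(x,y)=\exp\Big(\frac{u(x)+v(y)-c(x,y)}{\varepsilon}\Big)\,d\mu(x)\,d\nu(y).$$ -/

import Mathlib

namespace EntropicOT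

open MeasureTheory

variable {X Y : Type*} [MetricSpace X] [MetricSpace Y]
  [MeasurableSpace X] [MeasurableSpace Y]

/-- The set `Π(μ, ν)` of probability measures on `X × Y` with marginals `μ` and `ν`. -/
def couplings (μ : Measure X) (ν : Measure Y) : Set (Measure (X × Y)) :=
  {π | IsProbabilityMeasure π ∧
    (∀ A : Set X, MeasurableSet A → π (A ×ˢ Set.univ) = μ A) ∧
    (∀ B : Set Y, MeasurableSet B → π (Set.univ ×ˢ B) = ν B)}

open scoped Classical in
/-- The Kullback-Leibler functional `∫ (log (dπ/dξ) - 1) dπ` of two probability measures, with value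
`+∞` if `π` has no density with respect to `ξ`. The negative part of `log (dπ/dξ)` is always
`π`-integrable, so that the integral is `+∞` when `log (dπ/dξ)` is not integrable. -/
noncomputable def KL {Z : Type*} [MeasurableSpace Z] (π ξ : Measure Z) : EReal :=
  if π ≪ ξ ∧ Integrable (fun z => Real.log (π.rnDeriv ξ z).toReal) π then
    ((∫ z, (Real.log (π.rnDeriv ξ z).toReal - 1) ∂π : ℝ) : EReal)
  else ⊤

/-- The objective `∫ c dπ + ε KL(π | μ ⊗ ν)` of the primal problem. For `ε = 0` the second term is
zero, because `0 * ⊤ = 0` in `EReal`. -/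
noncomputable def primalObj (c : C(X × Y, ℝ)) (ε : ℝ) (μ : Measure X) (ν : Measure Y)
    (π : Measure (X × Y)) : EReal :=
  ((∫ z, c z ∂π : ℝ) : EReal) + (ε : EReal) * KL π (μ.prod ν)

/-- The value `W_ε(μ, ν)` of the primal problem. -/
noncomputable def W (c : C(X × Y, ℝ)) (ε : ℝ) (μ : Measure X) (ν : Measure Y) : EReal :=
  sInf (primalObj c ε μ ν '' couplings μ ν)

/-- `π` is a solution of the primal problem. -/
def SolvesPrimal (c : C(X × Y, ℝ)) (ε : ℝ) (μ : Measure X) (ν : Measure Y)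
    (π : Measure (X × Y)) : Prop :=
  π ∈ couplings μ ν ∧ ∀ π' ∈ couplings μ ν, primalObj c ε μ ν π ≤ primalObj c ε μ ν π'

/-- The constraint set `U_c` of pairs of continuous functions with `u ⊕ v ≤ c`. -/
def U (c : C(X × Y, ℝ)) : Set (C(X, ℝ) × C(Y, ℝ)) :=
  {p | ∀ (x : X) (y : Y), p.1 x + p.2 y ≤ c (x, y)}

open scoped Classical in
/-- The indicator function of `U_c` for `ε = 0`, and its smoothed approximation for `ε > 0`. -/
noncomputable def smoothedIndicator (c : C(X × Y, ℝ)) (ε : ℝ) (μ : Measure X) (ν : Measure Y)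
    (u : C(X, ℝ)) (v : C(Y, ℝ)) : EReal :=
  if ε = 0 then (if (u, v) ∈ U c then 0 else ⊤)
  else ((ε * ∫ z, Real.exp ((u z.1 + v z.2 - c z) / ε) ∂(μ.prod ν) : ℝ) : EReal)

/-- The dual objective `F_ε(u, v)`. -/
noncomputable def dualObj (c : C(X × Y, ℝ)) (ε : ℝ) (μ : Measure X) (ν : Measure Y)
    (u : C(X, ℝ)) (v : C(Y, ℝ)) : EReal :=
  ((∫ x, u x ∂μ + ∫ y, v y ∂ν : ℝ) : EReal) - smoothedIndicator c ε μ ν u v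

/-- `(u, v)` is a solution of the dual problem. -/
def SolvesDual (c : C(X × Y, ℝ)) (ε : ℝ) (μ : Measure X) (ν : Measure Y)
    (u : C(X, ℝ)) (v : C(Y, ℝ)) : Prop :=
  ∀ (u' : C(X, ℝ)) (v' : C(Y, ℝ)), dualObj c ε μ ν u' v' ≤ dualObj c ε μ ν u v

open scoped Classical in
/-- The `c`-transform of `v` for `ε = 0` (the infimum is a minimum when `Y` is compact and
nonempty), and its smoothed approximation for `ε > 0`. -/
noncomputable def cTransform (c : C(X × Y, ℝ)) (ε : ℝ) (ν : Measure Y) (v : C(Y, ℝ)) (x : X) : ℝ :=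
  if ε = 0 then ⨅ y : Y, (c (x, y) - v y)
  else -ε * Real.log (∫ y, Real.exp ((v y - c (x, y)) / ε) ∂ν)

/-- The semi-dual objective `H_ε(v)`. -/
noncomputable def semiDualObj (c : C(X × Y, ℝ)) (ε : ℝ) (μ : Measure X) (ν : Measure Y)
    (v : C(Y, ℝ)) : ℝ :=
  ∫ x, cTransform c ε ν v x ∂μ + ∫ y, v y ∂ν - ε

/-- `v` is a solution of the semi-dual problem. -/
def SolvesSemiDual (c : C(X × Y, ℝ)) (ε : ℝ) (μ : Measure X) (ν : Measure Y)
    (v : C(Y, ℝ)) : Prop :=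
  ∀ v' : C(Y, ℝ), semiDualObj c ε μ ν v' ≤ semiDualObj c ε μ ν v

end EntropicOT

/-!
Adding a constant to `v` does not change the semi-dual objective, and replacing `v` by its double
`c`-transform does not decrease it. Since `c`-transforms inherit the modulus of continuity of `c`,
the maximization may be restricted to a set of functions that is compact by the Arzelà-Ascoli
theorem; hence the semi-dual problem has a solution (`exists_solvesSemiDual`). This argument treats
all `ε ≥ 0` alike, because a `c`-transform is a soft minimum, and soft minima are monotone and
commute with the addition of constants.

For fixed `v`, the dual objective is maximal in `u` at the `c`-transform of `v`, with the value of
the semi-dual objective at `v`, and every maximizer agrees with the `c`-transform outside a `μ`-null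
set (`dualObj_le_semiDualObj`, `ae_eq_cTransform_of_dualObj_eq`). This relates the solutions of the
two problems. By symmetry, the second component of a dual solution is almost everywhere the
transform of the first; for `ε > 0` the two equations say that the measure `gibbs` with density
`exp ((u ⊕ v - c) / ε)` has marginals `μ` and `ν`.

The primal and the dual values are compared as follows.
* For `ε > 0`, the duality gap is `ε` times the integral of the gap in the Fenchel-Young inequality
  for `a log a - a` and `exp` (`primalObj_eq_dualObj_add`). It vanishes exactly when the
  coupling has density `exp ((u ⊕ v - c) / ε)`. This gives weak duality, strong duality and
  the uniqueness of the primal solution at once.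
* For `ε = 0`, weak duality is immediate. An optimal coupling is obtained from the Hahn-Banach
  theorem, applied to `f ↦ inf {∫ u dμ + ∫ v dν | f ≤ u ⊕ v}` at the point `-c`, and the
  Riesz-Markov-Kakutani theorem (`exists_coupling_integral_le`).
-/

namespace EntropicOT

open MeasureTheory

set_option linter.unusedSectionVars false

/-! ### Soft minima and `c`-transforms -/

variable {X Y : Type*} [MetricSpace X] [CompactSpace X] [MetricSpace Y] [CompactSpace Y]
  [MeasurableSpace X] [BorelSpace X] [MeasurableSpace Y] [BorelSpace Y]

lemma integrable_continuousMap (μ : Measure X) [IsFiniteMeasure μ] (f : C(X, ℝ)) :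
    Integrable f μ :=
  f.continuous.integrable_of_hasCompactSupport (HasCompactSupport.of_compactSpace f)

lemma integrable_of_continuous (μ : Measure X) [IsFiniteMeasure μ] {f : X → ℝ}
    (hf : Continuous f) : Integrable f μ :=
  integrable_continuousMap μ ⟨f, hf⟩

lemma integral_exp_pos_of_continuous (μ : Measure X) [IsProbabilityMeasure μ] {f : X → ℝ}
    (hf : Continuous f) : 0 < ∫ x, Real.exp (f x) ∂μ :=
  MeasureTheory.integral_exp_pos (integrable_of_continuous μ (by fun_prop))

open scoped Classical in
/-- The minimum of `f` for `ε = 0`, and its smooth approximation `-ε log ∫ exp (-f / ε) dν` for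
`ε > 0`. The (smoothed) `c`-transform of `v` at `x` is the soft minimum of `c (x, ·) - v`. -/
noncomputable def softMin (ε : ℝ) (ν : Measure Y) (f : C(Y, ℝ)) : ℝ :=
  if ε = 0 then ⨅ y, f y else -ε * Real.log (∫ y, Real.exp (-f y / ε) ∂ν)

lemma bddBelow_range_continuousMap (f : C(Y, ℝ)) : BddBelow (Set.range f) :=
  (isCompact_range f.continuous).bddBelow

lemma softMin_mono {ε : ℝ} (hε : 0 ≤ ε) (ν : Measure Y) [IsProbabilityMeasure ν]
    {f g : C(Y, ℝ)} (h : ∀ y, f y ≤ g y) : softMin ε ν f ≤ softMin ε ν g := by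
  unfold softMin
  split_ifs with h0
  · exact ciInf_mono (bddBelow_range_continuousMap f) h
  · have hpos : 0 < ε := lt_of_le_of_ne hε (Ne.symm h0)
    have hlog :
        Real.log (∫ y, Real.exp (-g y / ε) ∂ν) ≤ Real.log (∫ y, Real.exp (-f y / ε) ∂ν) := by
      refine Real.log_le_log (integral_exp_pos_of_continuous ν (by fun_prop)) ?_
      refine integral_mono (integrable_of_continuous ν (by fun_prop))
        (integrable_of_continuous ν (by fun_prop)) fun y => ?_
      have := h y
      dsimp only
      gcongr
    nlinarith

lemma softMin_add_const (ε : ℝ) (ν : Measure Y) [IsProbabilityMeasure ν]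
    (f : C(Y, ℝ)) (k : ℝ) : softMin ε ν (f + ContinuousMap.const Y k) = softMin ε ν f + k := by
  have : Nonempty Y := nonempty_of_isProbabilityMeasure ν
  unfold softMin
  split_ifs with h0
  · simp only [ContinuousMap.add_apply, ContinuousMap.const_apply]
    exact (ciInf_add (bddBelow_range_continuousMap f) k).symm
  · have : ∀ y, Real.exp (-(f + ContinuousMap.const Y k) y / ε)
        = Real.exp (-k / ε) * Real.exp (-f y / ε) := fun y => by
      rw [← Real.exp_add]; congr 1; simp; ring
    simp only [this]
    rw [integral_const_mul, Real.log_mul (Real.exp_ne_zero _)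
      (integral_exp_pos_of_continuous ν (by fun_prop)).ne', Real.log_exp]
    field_simp
    ring

lemma softMin_sub_le {ε : ℝ} (hε : 0 ≤ ε) (ν : Measure Y) [IsProbabilityMeasure ν]
    (f g : C(Y, ℝ)) : softMin ε ν f - softMin ε ν g ≤ ‖f - g‖ := by
  rw [sub_le_iff_le_add', ← softMin_add_const]
  refine softMin_mono hε ν fun y => ?_
  have := (le_abs_self _).trans ((f - g).norm_coe_le_norm y)
  simp only [ContinuousMap.sub_apply] at this
  simp only [ContinuousMap.add_apply, ContinuousMap.const_apply]
  linarith

/-- Monotonicity and commutation with constants make `softMin` nonexpansive. -/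
lemma abs_softMin_sub_le {ε : ℝ} (hε : 0 ≤ ε) (ν : Measure Y) [IsProbabilityMeasure ν]
    (f g : C(Y, ℝ)) : |softMin ε ν f - softMin ε ν g| ≤ ‖f - g‖ :=
  abs_sub_le_iff.2 ⟨softMin_sub_le hε ν f g, norm_sub_rev f g ▸ softMin_sub_le hε ν g f⟩

lemma cTransform_eq_softMin (c : C(X × Y, ℝ)) (ε : ℝ) (ν : Measure Y) (v : C(Y, ℝ)) (x : X) :
    cTransform c ε ν v x = softMin ε ν (c.curry x - v) := by
  simp [cTransform, softMin]

/-- A `c`-transform has the modulus of continuity of `c` in its first variable, whatever `v`. -/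
lemma abs_cTransform_sub_le_norm_curry (c : C(X × Y, ℝ)) {ε : ℝ} (hε : 0 ≤ ε) (ν : Measure Y)
    [IsProbabilityMeasure ν] (v : C(Y, ℝ)) (x x' : X) :
    |cTransform c ε ν v x - cTransform c ε ν v x'| ≤ ‖c.curry x - c.curry x'‖ := by
  rw [cTransform_eq_softMin, cTransform_eq_softMin]
  simpa using abs_softMin_sub_le hε ν (c.curry x - v) (c.curry x' - v)

lemma abs_cTransform_sub_le_norm_sub (c : C(X × Y, ℝ)) {ε : ℝ} (hε : 0 ≤ ε) (ν : Measure Y)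
    [IsProbabilityMeasure ν] (v w : C(Y, ℝ)) (x : X) :
    |cTransform c ε ν v x - cTransform c ε ν w x| ≤ ‖v - w‖ := by
  rw [cTransform_eq_softMin, cTransform_eq_softMin]
  simpa [norm_sub_rev w v] using abs_softMin_sub_le hε ν (c.curry x - v) (c.curry x - w)

lemma cTransform_add_const (c : C(X × Y, ℝ)) (ε : ℝ) (ν : Measure Y)
    [IsProbabilityMeasure ν] (v : C(Y, ℝ)) (k : ℝ) (x : X) :
    cTransform c ε ν (v + ContinuousMap.const Y k) x = cTransform c ε ν v x - k := by
  rw [cTransform_eq_softMin, cTransform_eq_softMin, eq_sub_iff_add_eq, ← softMin_add_const]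
  congr 1
  ext y
  simp only [ContinuousMap.add_apply, ContinuousMap.sub_apply, ContinuousMap.const_apply]
  ring

lemma continuous_of_abs_sub_le_norm_curry (c : C(X × Y, ℝ)) {f : X → ℝ}
    (hf : ∀ x x', |f x - f x'| ≤ ‖c.curry x - c.curry x'‖) : Continuous f := by
  rw [continuous_iff_continuousAt]
  intro x
  rw [ContinuousAt, tendsto_iff_dist_tendsto_zero]
  refine squeeze_zero (fun _ => dist_nonneg) (fun y => hf y x) ?_
  have := (c.curry.continuous.tendsto x)
  rwa [tendsto_iff_norm_sub_tendsto_zero] at this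

lemma continuous_cTransform (c : C(X × Y, ℝ)) {ε : ℝ} (hε : 0 ≤ ε) (ν : Measure Y)
    [IsProbabilityMeasure ν] (v : C(Y, ℝ)) : Continuous (cTransform c ε ν v) :=
  continuous_of_abs_sub_le_norm_curry c (abs_cTransform_sub_le_norm_curry c hε ν v)

/-- The `c`-transform of `v` as an element of `C(X, ℝ)`. -/
noncomputable def cTransformMap (c : C(X × Y, ℝ)) {ε : ℝ} (hε : 0 ≤ ε) (ν : Measure Y)
    [IsProbabilityMeasure ν] (v : C(Y, ℝ)) : C(X, ℝ) :=
  ⟨cTransform c ε ν v, continuous_cTransform c hε ν v⟩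

@[simp]
lemma cTransformMap_apply (c : C(X × Y, ℝ)) {ε : ℝ} (hε : 0 ≤ ε) (ν : Measure Y)
    [IsProbabilityMeasure ν] (v : C(Y, ℝ)) (x : X) :
    cTransformMap c hε ν v x = cTransform c ε ν v x := rfl

/-! ### The dual and the semi-dual objective -/

lemma exp_neg_cTransform (c : C(X × Y, ℝ)) {ε : ℝ} (hε : 0 < ε) (ν : Measure Y)
    [IsProbabilityMeasure ν] (v : C(Y, ℝ)) (x : X) :
    Real.exp (-cTransform c ε ν v x / ε) = ∫ y, Real.exp ((v y - c (x, y)) / ε) ∂ν := by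
  have h : -cTransform c ε ν v x / ε = Real.log (∫ y, Real.exp ((v y - c (x, y)) / ε) ∂ν) := by
    rw [cTransform, if_neg hε.ne']; field_simp
  rw [h, Real.exp_log (integral_exp_pos_of_continuous ν (by fun_prop))]

lemma integral_exp_add_sub (c : C(X × Y, ℝ)) {ε : ℝ} (hε : 0 < ε) (ν : Measure Y)
    [IsProbabilityMeasure ν] (a : ℝ) (v : C(Y, ℝ)) (x : X) :
    ∫ y, Real.exp ((a + v y - c (x, y)) / ε) ∂ν = Real.exp ((a - cTransform c ε ν v x) / ε) := by
  have : ∀ y, Real.exp ((a + v y - c (x, y)) / ε)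
      = Real.exp (a / ε) * Real.exp ((v y - c (x, y)) / ε) := fun y => by
    rw [← Real.exp_add]; ring_nf
  simp only [this]
  rw [integral_const_mul, ← exp_neg_cTransform c hε, ← Real.exp_add]
  ring_nf

lemma dualObj_of_pos (c : C(X × Y, ℝ)) {ε : ℝ} (hε : 0 < ε) (μ : Measure X) (ν : Measure Y)
    (u : C(X, ℝ)) (v : C(Y, ℝ)) :
    dualObj c ε μ ν u v = ((∫ x, u x ∂μ + ∫ y, v y ∂ν
      - ε * ∫ z, Real.exp ((u z.1 + v z.2 - c z) / ε) ∂(μ.prod ν) : ℝ) : EReal) := by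
  rw [dualObj, smoothedIndicator, if_neg hε.ne', EReal.coe_sub]

lemma dualObj_zero_of_mem (c : C(X × Y, ℝ)) (μ : Measure X) (ν : Measure Y)
    {u : C(X, ℝ)} {v : C(Y, ℝ)} (h : (u, v) ∈ U c) :
    dualObj c 0 μ ν u v = ((∫ x, u x ∂μ + ∫ y, v y ∂ν : ℝ) : EReal) := by
  simp [dualObj, smoothedIndicator, h]

lemma dualObj_zero_of_notMem (c : C(X × Y, ℝ)) (μ : Measure X) (ν : Measure Y)
    {u : C(X, ℝ)} {v : C(Y, ℝ)} (h : (u, v) ∉ U c) : dualObj c 0 μ ν u v = ⊥ := by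
  rw [dualObj, smoothedIndicator, if_pos rfl, if_neg h]
  exact EReal.sub_top _

/-- Integrating the exponential over `Y` first expresses the difference of the semi-dual and the
dual objective through the nonnegative function `t ↦ exp t - 1 - t`, which vanishes only at `0`. -/
lemma dualObj_eq_semiDualObj_sub (c : C(X × Y, ℝ)) {ε : ℝ} (hε : 0 < ε) (μ : Measure X)
    [IsProbabilityMeasure μ] (ν : Measure Y) [IsProbabilityMeasure ν]
    (u : C(X, ℝ)) (v : C(Y, ℝ)) :
    dualObj c ε μ ν u v = ((semiDualObj c ε μ ν v
      - ε * ∫ x, (Real.exp ((u x - cTransform c ε ν v x) / ε) - 1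
        - (u x - cTransform c ε ν v x) / ε) ∂μ : ℝ) : EReal) := by
  have hT := continuous_cTransform c hε.le ν v
  rw [dualObj_of_pos c hε, EReal.coe_eq_coe_iff]
  rw [integral_prod _ (integrable_of_continuous _ (by fun_prop))]
  simp only [integral_exp_add_sub c hε]
  rw [integral_sub (integrable_of_continuous _ (by fun_prop))
      (integrable_of_continuous _ (by fun_prop)),
    integral_sub (integrable_of_continuous _ (by fun_prop))
      (integrable_of_continuous _ (by fun_prop)), integral_div,
    integral_sub (integrable_of_continuous _ (by fun_prop))
      (integrable_of_continuous _ (by fun_prop)), semiDualObj]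
  simp
  field_simp
  ring

lemma le_cTransform_of_mem_U {c : C(X × Y, ℝ)} (ν : Measure Y) [IsProbabilityMeasure ν]
    {u : C(X, ℝ)} {v : C(Y, ℝ)} (h : (u, v) ∈ U c) (x : X) : u x ≤ cTransform c 0 ν v x := by
  have : Nonempty Y := nonempty_of_isProbabilityMeasure ν
  rw [cTransform, if_pos rfl]
  exact le_ciInf fun y => by have := h x y; dsimp only at this; linarith

lemma cTransformMap_mem_U (c : C(X × Y, ℝ)) (ν : Measure Y) [IsProbabilityMeasure ν]
    (v : C(Y, ℝ)) : (cTransformMap c le_rfl ν v, v) ∈ U c := by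
  intro x y
  rw [← le_sub_iff_add_le, cTransformMap_apply, cTransform, if_pos rfl]
  exact ciInf_le (bddBelow_range_continuousMap (c.curry x - v)) y

lemma dualObj_cTransformMap (c : C(X × Y, ℝ)) {ε : ℝ} (hε : 0 ≤ ε) (μ : Measure X)
    [IsProbabilityMeasure μ] (ν : Measure Y) [IsProbabilityMeasure ν] (v : C(Y, ℝ)) :
    dualObj c ε μ ν (cTransformMap c hε ν v) v = (semiDualObj c ε μ ν v : EReal) := by
  rcases hε.eq_or_lt with rfl | hpos
  · rw [dualObj_zero_of_mem c μ ν (cTransformMap_mem_U c ν v)]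
    simp [semiDualObj]
  · rw [dualObj_eq_semiDualObj_sub c hpos]
    simp

lemma dualObj_le_semiDualObj (c : C(X × Y, ℝ)) {ε : ℝ} (hε : 0 ≤ ε) (μ : Measure X)
    [IsProbabilityMeasure μ] (ν : Measure Y) [IsProbabilityMeasure ν]
    (u : C(X, ℝ)) (v : C(Y, ℝ)) :
    dualObj c ε μ ν u v ≤ (semiDualObj c ε μ ν v : EReal) := by
  rcases hε.eq_or_lt with rfl | hpos
  · by_cases h : (u, v) ∈ U c
    · rw [dualObj_zero_of_mem c μ ν h, EReal.coe_le_coe_iff, semiDualObj, sub_zero]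
      gcongr
      · exact integrable_continuousMap μ u
      · exact integrable_of_continuous μ (continuous_cTransform c le_rfl ν v)
      · exact fun x => le_cTransform_of_mem_U ν h x
    · rw [dualObj_zero_of_notMem c μ ν h]
      exact bot_le
  · rw [dualObj_eq_semiDualObj_sub c hpos, EReal.coe_le_coe_iff, sub_le_self_iff]
    refine mul_nonneg hε (integral_nonneg fun x => ?_)
    have := Real.add_one_le_exp ((u x - cTransform c ε ν v x) / ε)
    simp only [Pi.zero_apply]
    linarith

/-- Up to null sets, the `c`-transform of `v` is the only maximizer of the dual objective
in `u`. -/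
lemma ae_eq_cTransform_of_dualObj_eq (c : C(X × Y, ℝ)) {ε : ℝ} (hε : 0 ≤ ε) (μ : Measure X)
    [IsProbabilityMeasure μ] (ν : Measure Y) [IsProbabilityMeasure ν]
    {u : C(X, ℝ)} {v : C(Y, ℝ)}
    (h : dualObj c ε μ ν u v = (semiDualObj c ε μ ν v : EReal)) :
    ∀ᵐ x ∂μ, u x = cTransform c ε ν v x := by
  have hT := continuous_cTransform c hε ν v
  rcases hε.eq_or_lt with rfl | hpos
  · by_cases hU : (u, v) ∈ U c
    · rw [dualObj_zero_of_mem c μ ν hU, EReal.coe_eq_coe_iff, semiDualObj, sub_zero,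
        add_left_inj] at h
      exact (integral_eq_iff_of_ae_le (integrable_continuousMap μ u)
        (integrable_of_continuous μ hT)
        (Filter.Eventually.of_forall (le_cTransform_of_mem_U ν hU))).1 h
    · rw [dualObj_zero_of_notMem c μ ν hU] at h
      exact absurd h (EReal.bot_ne_coe _)
  · rw [dualObj_eq_semiDualObj_sub c hpos, EReal.coe_eq_coe_iff, sub_eq_self,
      mul_eq_zero_iff_left hpos.ne', integral_eq_zero_iff_of_nonneg] at h
    · filter_upwards [h] with x hx
      by_contra hne
      have := Real.add_one_lt_exp (div_ne_zero (sub_ne_zero.2 hne) hpos.ne')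
      simp only [Pi.zero_apply] at hx
      linarith
    · intro x
      have := Real.add_one_le_exp ((u x - cTransform c ε ν v x) / ε)
      simp only [Pi.zero_apply]
      linarith
    · exact integrable_of_continuous μ (by fun_prop)

/-- The cost with the roles of the two spaces exchanged. -/
def swapCost (c : C(X × Y, ℝ)) : C(Y × X, ℝ) := c.comp ⟨Prod.swap, continuous_swap⟩

@[simp]
lemma swapCost_apply (c : C(X × Y, ℝ)) (z : Y × X) : swapCost c z = c z.swap := rfl

lemma dualObj_swapCost (c : C(X × Y, ℝ)) (ε : ℝ) (μ : Measure X)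
    [IsProbabilityMeasure μ] (ν : Measure Y) [IsProbabilityMeasure ν]
    (u : C(X, ℝ)) (v : C(Y, ℝ)) :
    dualObj (swapCost c) ε ν μ v u = dualObj c ε μ ν u v := by
  have h1 : (v, u) ∈ U (swapCost c) ↔ (u, v) ∈ U c := by
    simp only [U, Set.mem_ofPred_eq, swapCost_apply, Prod.swap_prod_mk]
    rw [forall_comm]
    simp only [add_comm]
  have h2 : ∫ z, Real.exp ((v z.1 + u z.2 - swapCost c z) / ε) ∂(ν.prod μ)
      = ∫ z, Real.exp ((u z.1 + v z.2 - c z) / ε) ∂(μ.prod ν) := by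
    rw [← integral_prod_swap]
    simp [add_comm]
  rw [dualObj, dualObj, smoothedIndicator, smoothedIndicator, h2, add_comm (∫ y, v y ∂ν),
    propext h1]

lemma semiDualObj_add_const (c : C(X × Y, ℝ)) {ε : ℝ} (hε : 0 ≤ ε) (μ : Measure X)
    [IsProbabilityMeasure μ] (ν : Measure Y) [IsProbabilityMeasure ν] (v : C(Y, ℝ)) (k : ℝ) :
    semiDualObj c ε μ ν (v + ContinuousMap.const Y k) = semiDualObj c ε μ ν v := by
  simp only [semiDualObj, cTransform_add_const, ContinuousMap.add_apply,
    ContinuousMap.const_apply]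
  rw [integral_sub (integrable_of_continuous μ (continuous_cTransform c hε ν v))
    (integrable_const _), integral_add (integrable_continuousMap ν v) (integrable_const _)]
  simp

/-- Passing to the double `c`-transform increases the semi-dual objective. -/
lemma semiDualObj_le_semiDualObj_cTransformMap (c : C(X × Y, ℝ)) {ε : ℝ} (hε : 0 ≤ ε)
    (μ : Measure X) [IsProbabilityMeasure μ] (ν : Measure Y) [IsProbabilityMeasure ν]
    (v : C(Y, ℝ)) :
    semiDualObj c ε μ ν v ≤ semiDualObj c ε μ ν
      (cTransformMap (swapCost c) hε μ (cTransformMap c hε ν v)) := by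
  set u := cTransformMap c hε ν v
  rw [← EReal.coe_le_coe_iff]
  calc (semiDualObj c ε μ ν v : EReal) = dualObj c ε μ ν u v :=
        (dualObj_cTransformMap c hε μ ν v).symm
    _ = dualObj (swapCost c) ε ν μ v u := (dualObj_swapCost c ε μ ν u v).symm
    _ ≤ semiDualObj (swapCost c) ε ν μ u := dualObj_le_semiDualObj _ hε ν μ v u
    _ = dualObj (swapCost c) ε ν μ (cTransformMap (swapCost c) hε μ u) u :=
        (dualObj_cTransformMap _ hε ν μ u).symm
    _ = dualObj c ε μ ν u (cTransformMap (swapCost c) hε μ u) := dualObj_swapCost c ε μ ν _ _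
    _ ≤ _ := dualObj_le_semiDualObj c hε μ ν _ _

lemma continuous_integral_continuousMap (μ : Measure X) [IsProbabilityMeasure μ] :
    Continuous fun f : C(X, ℝ) => ∫ x, f x ∂μ := by
  refine (LipschitzWith.of_dist_le_mul (K := 1) fun f g => ?_).continuous
  rw [Real.dist_eq, ← integral_sub (integrable_continuousMap μ f) (integrable_continuousMap μ g),
    NNReal.coe_one, one_mul, dist_eq_norm]
  simpa using norm_integral_le_of_norm_le_const (μ := μ)
    (Filter.Eventually.of_forall fun x => (f - g).norm_coe_le_norm x)

lemma continuous_cTransformMap (c : C(X × Y, ℝ)) {ε : ℝ} (hε : 0 ≤ ε) (ν : Measure Y)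
    [IsProbabilityMeasure ν] : Continuous (cTransformMap c hε ν) := by
  refine (LipschitzWith.of_dist_le_mul (K := 1) fun v w => ?_).continuous
  rw [NNReal.coe_one, one_mul, dist_eq_norm v w, ContinuousMap.dist_le (norm_nonneg _)]
  exact fun x => abs_cTransform_sub_le_norm_sub c hε ν v w x

lemma continuous_semiDualObj (c : C(X × Y, ℝ)) {ε : ℝ} (hε : 0 ≤ ε) (μ : Measure X)
    [IsProbabilityMeasure μ] (ν : Measure Y) [IsProbabilityMeasure ν] :
    Continuous (semiDualObj c ε μ ν) :=
  (((continuous_integral_continuousMap μ).comp (continuous_cTransformMap c hε ν)).add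
    (continuous_integral_continuousMap ν)).sub continuous_const

/-- By the Arzelà-Ascoli theorem, the functions that vanish at `x₀` and have the modulus of
continuity of `c` in its first variable form a compact set. -/
lemma isCompact_setOf_abs_sub_le_norm_curry (c : C(X × Y, ℝ)) (x₀ : X) :
    IsCompact {f : C(X, ℝ) | f x₀ = 0 ∧ ∀ x x', |f x - f x'| ≤ ‖c.curry x - c.curry x'‖} := by
  refine ArzelaAscoli.isCompact_of_equicontinuous _ ?_ ?_
  · have himage : ContinuousMap.toFun ''
        {f : C(X, ℝ) | f x₀ = 0 ∧ ∀ x x', |f x - f x'| ≤ ‖c.curry x - c.curry x'‖}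
        = {f : X → ℝ | f x₀ = 0 ∧ ∀ x x', |f x - f x'| ≤ ‖c.curry x - c.curry x'‖} := by
      ext f
      constructor
      · rintro ⟨g, hg, rfl⟩
        exact hg
      · exact fun hf => ⟨⟨f, continuous_of_abs_sub_le_norm_curry c hf.2⟩, hf, rfl⟩
    rw [himage]
    refine (isCompact_univ_pi fun x => isCompact_Icc
      (a := -‖c.curry x - c.curry x₀‖) (b := ‖c.curry x - c.curry x₀‖)).of_isClosed_subset ?_ ?_
    · simp only [Set.ofPred_and, Set.ofPred_forall]
      refine (isClosed_eq (by fun_prop) (by fun_prop)).inter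
        (isClosed_iInter fun x => isClosed_iInter fun x' => isClosed_le (by fun_prop) (by fun_prop))
    · intro f hf x _
      have := hf.2 x x₀
      rw [hf.1, sub_zero] at this
      exact abs_le.1 this
  · intro x
    rw [Metric.equicontinuousAt_iff_right]
    intro δ hδ
    have h := Metric.tendsto_nhds.1 (c.curry.continuous.tendsto x) δ hδ
    filter_upwards [h] with x' hx' f
    rw [dist_comm] at hx'
    exact (f.2.2 x x').trans_lt (by rwa [dist_eq_norm] at hx')

/-- The semi-dual problem has a solution: by translation invariance and the double `c`-transform,
the supremum may be restricted to a compact set. -/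
lemma exists_solvesSemiDual (c : C(X × Y, ℝ)) {ε : ℝ} (hε : 0 ≤ ε) (μ : Measure X)
    [IsProbabilityMeasure μ] (ν : Measure Y) [IsProbabilityMeasure ν] :
    ∃ v, SolvesSemiDual c ε μ ν v := by
  obtain ⟨y₀⟩ : Nonempty Y := nonempty_of_isProbabilityMeasure ν
  obtain ⟨v, -, hv⟩ := (isCompact_setOf_abs_sub_le_norm_curry (swapCost c) y₀).exists_isMaxOn
    ⟨0, by simp⟩ (continuous_semiDualObj c hε μ ν).continuousOn
  refine ⟨v, fun v' => ?_⟩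
  set w := cTransformMap (swapCost c) hε μ (cTransformMap c hε ν v') with hw
  calc semiDualObj c ε μ ν v' ≤ semiDualObj c ε μ ν w :=
        semiDualObj_le_semiDualObj_cTransformMap c hε μ ν v'
    _ = semiDualObj c ε μ ν (w + ContinuousMap.const Y (-w y₀)) :=
        (semiDualObj_add_const c hε μ ν w _).symm
    _ ≤ semiDualObj c ε μ ν v := hv ⟨by simp, fun y y' => by
        simpa [hw] using abs_cTransform_sub_le_norm_curry (swapCost c) hε μ _ y y'⟩

lemma solvesDual_cTransformMap (c : C(X × Y, ℝ)) {ε : ℝ} (hε : 0 ≤ ε) (μ : Measure X)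
    [IsProbabilityMeasure μ] (ν : Measure Y) [IsProbabilityMeasure ν] {v : C(Y, ℝ)}
    (hv : SolvesSemiDual c ε μ ν v) : SolvesDual c ε μ ν (cTransformMap c hε ν v) v := by
  intro u' v'
  rw [dualObj_cTransformMap]
  exact (dualObj_le_semiDualObj c hε μ ν u' v').trans (EReal.coe_le_coe_iff.2 (hv v'))

lemma SolvesDual.dualObj_eq {c : C(X × Y, ℝ)} {ε : ℝ} (hε : 0 ≤ ε) {μ : Measure X}
    [IsProbabilityMeasure μ] {ν : Measure Y} [IsProbabilityMeasure ν] {u : C(X, ℝ)} {v : C(Y, ℝ)}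
    (h : SolvesDual c ε μ ν u v) : dualObj c ε μ ν u v = (semiDualObj c ε μ ν v : EReal) :=
  (dualObj_le_semiDualObj c hε μ ν u v).antisymm (dualObj_cTransformMap c hε μ ν v ▸ h _ _)

lemma SolvesDual.solvesSemiDual {c : C(X × Y, ℝ)} {ε : ℝ} (hε : 0 ≤ ε) {μ : Measure X}
    [IsProbabilityMeasure μ] {ν : Measure Y} [IsProbabilityMeasure ν] {u : C(X, ℝ)} {v : C(Y, ℝ)}
    (h : SolvesDual c ε μ ν u v) : SolvesSemiDual c ε μ ν v := by
  intro v'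
  rw [← EReal.coe_le_coe_iff, ← h.dualObj_eq hε, ← dualObj_cTransformMap c hε μ ν v']
  exact h _ _

lemma SolvesDual.swap {c : C(X × Y, ℝ)} {ε : ℝ} {μ : Measure X}
    [IsProbabilityMeasure μ] {ν : Measure Y} [IsProbabilityMeasure ν] {u : C(X, ℝ)} {v : C(Y, ℝ)}
    (h : SolvesDual c ε μ ν u v) : SolvesDual (swapCost c) ε ν μ v u := by
  intro v' u'
  rw [dualObj_swapCost, dualObj_swapCost]
  exact h u' v'

/-! ### Couplings and weak duality -/

lemma mem_couplings_iff {μ : Measure X} [IsProbabilityMeasure μ] {ν : Measure Y}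
    {π : Measure (X × Y)} : π ∈ couplings μ ν ↔ π.map Prod.fst = μ ∧ π.map Prod.snd = ν := by
  constructor
  · rintro ⟨-, h1, h2⟩
    constructor
    · ext A hA
      rw [Measure.map_apply measurable_fst hA, ← h1 A hA, Set.prod_univ]
    · ext B hB
      rw [Measure.map_apply measurable_snd hB, ← h2 B hB, Set.univ_prod]
  · rintro ⟨h1, h2⟩
    refine ⟨⟨?_⟩, fun A hA => ?_, fun B hB => ?_⟩
    · rw [← measure_univ (μ := μ), ← h1, Measure.map_apply measurable_fst .univ, Set.preimage_univ]
    · rw [← h1, Measure.map_apply measurable_fst hA, Set.prod_univ]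
    · rw [← h2, Measure.map_apply measurable_snd hB, Set.univ_prod]

lemma prod_mem_couplings (μ : Measure X) [IsProbabilityMeasure μ] (ν : Measure Y)
    [IsProbabilityMeasure ν] : μ.prod ν ∈ couplings μ ν :=
  mem_couplings_iff.2 ⟨by simp, by simp⟩

lemma integral_add_of_mem_couplings {μ : Measure X} [IsProbabilityMeasure μ] {ν : Measure Y}
    [IsProbabilityMeasure ν] {π : Measure (X × Y)} (hπ : π ∈ couplings μ ν)
    (u : C(X, ℝ)) (v : C(Y, ℝ)) :
    ∫ z, (u z.1 + v z.2) ∂π = ∫ x, u x ∂μ + ∫ y, v y ∂ν := by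
  have := hπ.1
  obtain ⟨h1, h2⟩ := mem_couplings_iff.1 hπ
  rw [integral_add (integrable_of_continuous π (by fun_prop))
    (integrable_of_continuous π (by fun_prop)), ← h1, ← h2,
    integral_map measurable_fst.aemeasurable u.continuous.aestronglyMeasurable,
    integral_map measurable_snd.aemeasurable v.continuous.aestronglyMeasurable]

/-- Here `0 * ⊤ = 0` in `EReal`, so that couplings without a density are not penalized. -/
lemma primalObj_zero (c : C(X × Y, ℝ)) (μ : Measure X) (ν : Measure Y) (π : Measure (X × Y)) :
    primalObj c 0 μ ν π = ((∫ z, c z ∂π : ℝ) : EReal) := by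
  simp [primalObj]

lemma integral_add_le_of_mem_U {c : C(X × Y, ℝ)} {μ : Measure X} [IsProbabilityMeasure μ]
    {ν : Measure Y} [IsProbabilityMeasure ν] {π : Measure (X × Y)} (hπ : π ∈ couplings μ ν)
    {u : C(X, ℝ)} {v : C(Y, ℝ)} (h : (u, v) ∈ U c) :
    ∫ x, u x ∂μ + ∫ y, v y ∂ν ≤ ∫ z, c z ∂π := by
  have := hπ.1
  rw [← integral_add_of_mem_couplings hπ]
  exact integral_mono (integrable_of_continuous π (by fun_prop)) (integrable_continuousMap π c)
    fun z => h z.1 z.2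

/-- The Fenchel-Young inequality for the conjugate pair `a ↦ a log a - a` and `exp`. -/
lemma mul_log_sub_sub_mul_add_exp_nonneg {a : ℝ} (ha : 0 ≤ a) (t : ℝ) :
    0 ≤ a * (Real.log a - 1 - t) + Real.exp t := by
  rcases ha.eq_or_lt with rfl | hpos
  · simpa using (Real.exp_pos t).le
  · have h := Real.add_one_le_exp (t - Real.log a)
    rw [Real.exp_sub, Real.exp_log hpos, le_div_iff₀ hpos] at h
    linarith

lemma eq_exp_of_mul_log_sub_sub_mul_add_exp_eq_zero {a : ℝ} (ha : 0 ≤ a) {t : ℝ}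
    (h : a * (Real.log a - 1 - t) + Real.exp t = 0) : a = Real.exp t := by
  rcases ha.eq_or_lt with rfl | hpos
  · simp at h
  · by_contra hne
    have hne' : t - Real.log a ≠ 0 := fun h0 => hne <| by
      rw [sub_eq_zero.1 h0, Real.exp_log hpos]
    have h' := Real.add_one_lt_exp hne'
    rw [Real.exp_sub, Real.exp_log hpos, lt_div_iff₀ hpos] at h'
    linarith

/-- For `ε > 0`, the duality gap of a coupling with finite entropy is `ε` times the integral of the
gap in the Fenchel-Young inequality. -/
lemma primalObj_eq_dualObj_add (c : C(X × Y, ℝ)) {ε : ℝ} (hε : 0 < ε) {μ : Measure X}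
    [IsProbabilityMeasure μ] {ν : Measure Y} [IsProbabilityMeasure ν] {π : Measure (X × Y)}
    (hπ : π ∈ couplings μ ν) (hac : π ≪ μ.prod ν)
    (hint : Integrable (fun z => Real.log (π.rnDeriv (μ.prod ν) z).toReal) π)
    (u : C(X, ℝ)) (v : C(Y, ℝ)) :
    Integrable (fun z => (π.rnDeriv (μ.prod ν) z).toReal *
      (Real.log (π.rnDeriv (μ.prod ν) z).toReal - 1 - (u z.1 + v z.2 - c z) / ε)
        + Real.exp ((u z.1 + v z.2 - c z) / ε)) (μ.prod ν) ∧
    primalObj c ε μ ν π = dualObj c ε μ ν u v +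
      ((ε * ∫ z, ((π.rnDeriv (μ.prod ν) z).toReal *
        (Real.log (π.rnDeriv (μ.prod ν) z).toReal - 1 - (u z.1 + v z.2 - c z) / ε)
          + Real.exp ((u z.1 + v z.2 - c z) / ε)) ∂(μ.prod ν) : ℝ) : EReal) := by
  have := hπ.1
  -- instance search does not find this one here
  have : SigmaFinite (μ.prod ν) := IsFiniteMeasure.toSigmaFinite _
  have hexp : Integrable (fun z : X × Y => Real.exp ((u z.1 + v z.2 - c z) / ε)) (μ.prod ν) :=
    integrable_of_continuous _ (by fun_prop)
  have hg : Integrable (fun z : X × Y => (u z.1 + v z.2 - c z) / ε) π :=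
    integrable_of_continuous _ (by fun_prop)
  have hlog : Integrable (fun z => Real.log (π.rnDeriv (μ.prod ν) z).toReal - 1) π :=
    hint.sub (integrable_const (1 : ℝ))
  have hmul : Integrable (fun z => (π.rnDeriv (μ.prod ν) z).toReal *
      (Real.log (π.rnDeriv (μ.prod ν) z).toReal - 1 - (u z.1 + v z.2 - c z) / ε)) (μ.prod ν) :=
    (integrable_rnDeriv_smul_iff hac).2 (hlog.sub hg)
  refine ⟨hmul.add hexp, ?_⟩
  rw [primalObj, KL, if_pos ⟨hac, hint⟩, dualObj_of_pos c hε, ← EReal.coe_mul, ← EReal.coe_add,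
    ← EReal.coe_add, EReal.coe_eq_coe_iff, integral_add hmul hexp]
  have h1 : ∫ z, (π.rnDeriv (μ.prod ν) z).toReal *
      (Real.log (π.rnDeriv (μ.prod ν) z).toReal - 1 - (u z.1 + v z.2 - c z) / ε) ∂(μ.prod ν)
      = ∫ z, (Real.log (π.rnDeriv (μ.prod ν) z).toReal - 1) ∂π
        - (∫ x, u x ∂μ + ∫ y, v y ∂ν - ∫ z, c z ∂π) / ε := by
    rw [← integral_add_of_mem_couplings hπ, ← integral_sub (integrable_of_continuous π
      (by fun_prop)) (integrable_continuousMap π c), ← integral_div, ← integral_sub hlog hg]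
    exact integral_rnDeriv_smul hac
  rw [h1]
  field_simp
  ring

/-- For `ε > 0`, a measure without finite entropy has infinite cost. -/
lemma primalObj_of_not (c : C(X × Y, ℝ)) {ε : ℝ} (hε : 0 < ε) {μ : Measure X}
    {ν : Measure Y} {π : Measure (X × Y)} (h : ¬ (π ≪ μ.prod ν ∧
      Integrable (fun z => Real.log (π.rnDeriv (μ.prod ν) z).toReal) π)) :
    primalObj c ε μ ν π = ⊤ := by
  rw [primalObj, KL, if_neg h, EReal.coe_mul_top_of_pos hε, EReal.coe_add_top]

/-- Weak duality, for all `ε ≥ 0`. -/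
lemma dualObj_le_primalObj (c : C(X × Y, ℝ)) {ε : ℝ} (hε : 0 ≤ ε) {μ : Measure X}
    [IsProbabilityMeasure μ] {ν : Measure Y} [IsProbabilityMeasure ν] {π : Measure (X × Y)}
    (hπ : π ∈ couplings μ ν) (u : C(X, ℝ)) (v : C(Y, ℝ)) :
    dualObj c ε μ ν u v ≤ primalObj c ε μ ν π := by
  rcases hε.eq_or_lt with rfl | hpos
  · by_cases h : (u, v) ∈ U c
    · rw [dualObj_zero_of_mem c μ ν h, primalObj_zero, EReal.coe_le_coe_iff]
      exact integral_add_le_of_mem_U hπ h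
    · rw [dualObj_zero_of_notMem c μ ν h]
      exact bot_le
  · by_cases h : π ≪ μ.prod ν ∧ Integrable (fun z => Real.log (π.rnDeriv (μ.prod ν) z).toReal) π
    · rw [(primalObj_eq_dualObj_add c hpos hπ h.1 h.2 u v).2]
      refine le_add_of_nonneg_right (EReal.coe_nonneg.2 (mul_nonneg hε (integral_nonneg fun z =>
        mul_log_sub_sub_mul_add_exp_nonneg ENNReal.toReal_nonneg _)))
    · rw [primalObj_of_not c hpos h]
      exact le_top

/-- The measure with density `exp ((u ⊕ v - c) / ε)` with respect to `μ ⊗ ν`. -/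
noncomputable def gibbs (c : C(X × Y, ℝ)) (ε : ℝ) (μ : Measure X) (ν : Measure Y)
    (u : C(X, ℝ)) (v : C(Y, ℝ)) : Measure (X × Y) :=
  (μ.prod ν).withDensity (fun z => ENNReal.ofReal (Real.exp ((u z.1 + v z.2 - c z) / ε)))

/-- The equality case of weak duality. -/
lemma eq_gibbs_of_primalObj_le_dualObj (c : C(X × Y, ℝ)) {ε : ℝ} (hε : 0 < ε) {μ : Measure X}
    [IsProbabilityMeasure μ] {ν : Measure Y} [IsProbabilityMeasure ν] {π : Measure (X × Y)}
    (hπ : π ∈ couplings μ ν) (u : C(X, ℝ)) (v : C(Y, ℝ))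
    (hle : primalObj c ε μ ν π ≤ dualObj c ε μ ν u v) : π = gibbs c ε μ ν u v := by
  have := hπ.1
  -- instance search does not find this one here
  have : SigmaFinite (μ.prod ν) := IsFiniteMeasure.toSigmaFinite _
  by_cases h : π ≪ μ.prod ν ∧ Integrable (fun z => Real.log (π.rnDeriv (μ.prod ν) z).toReal) π
  · obtain ⟨hint, heq⟩ := primalObj_eq_dualObj_add c hε hπ h.1 h.2 u v
    have hnn : 0 ≤ fun z => (π.rnDeriv (μ.prod ν) z).toReal *
        (Real.log (π.rnDeriv (μ.prod ν) z).toReal - 1 - (u z.1 + v z.2 - c z) / ε)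
          + Real.exp ((u z.1 + v z.2 - c z) / ε) := fun z =>
      mul_log_sub_sub_mul_add_exp_nonneg ENNReal.toReal_nonneg _
    rw [heq, dualObj_of_pos c hε, ← EReal.coe_add, EReal.coe_le_coe_iff,
      add_le_iff_nonpos_right] at hle
    have hzero := (nonpos_of_mul_nonpos_right hle hε).antisymm (integral_nonneg hnn)
    rw [integral_eq_zero_iff_of_nonneg hnn hint] at hzero
    rw [← Measure.withDensity_rnDeriv_eq π (μ.prod ν) h.1, gibbs]
    refine withDensity_congr_ae ?_
    filter_upwards [hzero, Measure.rnDeriv_lt_top π (μ.prod ν)] with z hz hlt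
    rw [← eq_exp_of_mul_log_sub_sub_mul_add_exp_eq_zero ENNReal.toReal_nonneg hz,
      ENNReal.ofReal_toReal hlt.ne]
  · rw [primalObj_of_not c hε h, dualObj_of_pos c hε] at hle
    exact absurd hle (EReal.coe_lt_top _).not_ge

/-- The equation `u = v^{c,ε}` is the first marginal condition for the Gibbs measure. -/
lemma map_fst_gibbs (c : C(X × Y, ℝ)) {ε : ℝ} (hε : 0 < ε) {μ : Measure X}
    [IsProbabilityMeasure μ] {ν : Measure Y} [IsProbabilityMeasure ν]
    {u : C(X, ℝ)} {v : C(Y, ℝ)} (h : ∀ᵐ x ∂μ, u x = cTransform c ε ν v x) :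
    (gibbs c ε μ ν u v).map Prod.fst = μ := by
  have hm : Measurable fun z : X × Y =>
      ENNReal.ofReal (Real.exp ((u z.1 + v z.2 - c z) / ε)) := by
    have : Continuous fun z : X × Y => (u z.1 + v z.2 - c z) / ε := by fun_prop
    exact this.measurable.exp.ennreal_ofReal
  ext A hA
  rw [Measure.map_apply measurable_fst hA, gibbs, withDensity_apply _ (measurable_fst hA),
    ← Set.prod_univ, setLIntegral_prod _ hm.aemeasurable.restrict, ← setLIntegral_one]
  refine lintegral_congr_ae (ae_restrict_of_ae ?_)
  filter_upwards [h] with x hx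
  rw [Measure.restrict_univ, ← ofReal_integral_eq_lintegral_ofReal
    (integrable_of_continuous ν (by fun_prop)) (Filter.Eventually.of_forall fun y =>
      (Real.exp_pos _).le), integral_exp_add_sub c hε, hx]
  simp

lemma map_swap_gibbs_swapCost (c : C(X × Y, ℝ)) (ε : ℝ) {μ : Measure X}
    [IsProbabilityMeasure μ] {ν : Measure Y} [IsProbabilityMeasure ν]
    (u : C(X, ℝ)) (v : C(Y, ℝ)) :
    (gibbs (swapCost c) ε ν μ v u).map Prod.swap = gibbs c ε μ ν u v := by
  have hm : Measurable fun z : X × Y =>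
      ENNReal.ofReal (Real.exp ((u z.1 + v z.2 - c z) / ε)) := by
    have : Continuous fun z : X × Y => (u z.1 + v z.2 - c z) / ε := by fun_prop
    exact this.measurable.exp.ennreal_ofReal
  ext A hA
  rw [Measure.map_apply measurable_swap hA, gibbs, gibbs, withDensity_apply _ hA,
    withDensity_apply _ (measurable_swap hA), ← Measure.prod_swap (μ := ν) (ν := μ),
    setLIntegral_map hA hm measurable_swap]
  simp [add_comm]

/-- The second marginal condition is the first one for the problem with `X` and `Y` exchanged. -/
lemma gibbs_mem_couplings (c : C(X × Y, ℝ)) {ε : ℝ} (hε : 0 < ε) {μ : Measure X}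
    [IsProbabilityMeasure μ] {ν : Measure Y} [IsProbabilityMeasure ν]
    {u : C(X, ℝ)} {v : C(Y, ℝ)} (h : SolvesDual c ε μ ν u v) :
    gibbs c ε μ ν u v ∈ couplings μ ν := by
  refine mem_couplings_iff.2 ⟨map_fst_gibbs c hε
    (ae_eq_cTransform_of_dualObj_eq c hε.le μ ν (h.dualObj_eq hε.le)), ?_⟩
  rw [← map_swap_gibbs_swapCost, Measure.map_map measurable_snd measurable_swap]
  exact map_fst_gibbs _ hε
    (ae_eq_cTransform_of_dualObj_eq _ hε.le ν μ (h.swap.dualObj_eq hε.le))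

lemma primalObj_gibbs (c : C(X × Y, ℝ)) {ε : ℝ} (hε : 0 < ε) {μ : Measure X}
    [IsProbabilityMeasure μ] {ν : Measure Y} [IsProbabilityMeasure ν]
    {u : C(X, ℝ)} {v : C(Y, ℝ)} (h : gibbs c ε μ ν u v ∈ couplings μ ν) :
    primalObj c ε μ ν (gibbs c ε μ ν u v) = dualObj c ε μ ν u v := by
  have := h.1
  have hcont : Continuous fun z : X × Y => (u z.1 + v z.2 - c z) / ε := by fun_prop
  have hac : gibbs c ε μ ν u v ≪ μ.prod ν := withDensity_absolutelyContinuous _ _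
  have hrn : ∀ᵐ z ∂(μ.prod ν), ((gibbs c ε μ ν u v).rnDeriv (μ.prod ν) z).toReal
      = Real.exp ((u z.1 + v z.2 - c z) / ε) := by
    filter_upwards [Measure.rnDeriv_withDensity (μ.prod ν)
      hcont.measurable.exp.ennreal_ofReal] with z hz
    rw [gibbs, hz, ENNReal.toReal_ofReal (Real.exp_pos _).le]
  have hint : Integrable (fun z =>
      Real.log ((gibbs c ε μ ν u v).rnDeriv (μ.prod ν) z).toReal) (gibbs c ε μ ν u v) := by
    refine (integrable_of_continuous _ hcont).congr ?_
    filter_upwards [hac.ae_le hrn] with z hz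
    rw [hz, Real.log_exp]
  rw [(primalObj_eq_dualObj_add c hε h hac hint u v).2, integral_eq_zero_of_ae, mul_zero,
    EReal.coe_zero, add_zero]
  filter_upwards [hrn] with z hz
  rw [hz, Real.log_exp]
  simp

/-! ### Kantorovich duality -/

/-- The Hahn-Banach theorem: a sublinear function has a linear minorant that touches it at a
prescribed point. -/
lemma exists_linearMap_le_sublinear_eq {E : Type*} [AddCommGroup E] [Module ℝ E] (N : E → ℝ)
    (N_hom : ∀ t : ℝ, 0 < t → ∀ x, N (t • x) = t * N x) (N_add : ∀ x y, N (x + y) ≤ N x + N y)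
    (x : E) : ∃ g : E →ₗ[ℝ] ℝ, g x = N x ∧ ∀ y, g y ≤ N y := by
  have N_zero : N 0 = 0 := by
    have := N_hom 2 two_pos 0
    rw [smul_zero] at this
    linarith
  have hle : ∀ t : ℝ, t * N x ≤ N (t • x) := by
    intro t
    rcases lt_trichotomy t 0 with ht | rfl | ht
    · have h1 := N_add (t • x) (-t • x)
      rw [← add_smul, add_neg_cancel, zero_smul, N_zero, N_hom (-t) (neg_pos.2 ht)] at h1
      linarith
    · simp [N_zero]
    · exact (N_hom t ht x).ge
  obtain ⟨g, hg, hgN⟩ := exists_extension_of_le_sublinear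
    (LinearPMap.mkSpanSingleton' x (N x) fun t ht => by
      rcases smul_eq_zero.1 ht with rfl | rfl
      · simp
      · simp [N_zero]) N N_hom N_add (by
      rintro ⟨y, hy⟩
      obtain ⟨t, rfl⟩ := Submodule.mem_span_singleton.1 hy
      rw [LinearPMap.mkSpanSingleton'_apply]
      exact hle t)
  refine ⟨g, ?_, hgN⟩
  exact (hg ⟨x, Submodule.mem_span_singleton_self x⟩).trans
    (LinearPMap.mkSpanSingleton'_apply_self _ _ _ _)

/-- The infimum of `∫ u dμ + ∫ v dν` over the continuous functions with `f ≤ u ⊕ v`. -/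
noncomputable def superhedge (μ : Measure X) (ν : Measure Y) (f : C(X × Y, ℝ)) : ℝ :=
  sInf {r | ∃ (u : C(X, ℝ)) (v : C(Y, ℝ)), (∀ x y, f (x, y) ≤ u x + v y) ∧
    r = ∫ x, u x ∂μ + ∫ y, v y ∂ν}

lemma superhedge_le (μ : Measure X) [IsProbabilityMeasure μ] (ν : Measure Y)
    [IsProbabilityMeasure ν] {f : C(X × Y, ℝ)} {u : C(X, ℝ)} {v : C(Y, ℝ)}
    (h : ∀ x y, f (x, y) ≤ u x + v y) : superhedge μ ν f ≤ ∫ x, u x ∂μ + ∫ y, v y ∂ν := by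
  refine csInf_le ⟨∫ z, f z ∂(μ.prod ν), ?_⟩ ⟨u, v, h, rfl⟩
  rintro _ ⟨u, v, h, rfl⟩
  rw [← integral_add_of_mem_couplings (prod_mem_couplings μ ν)]
  exact integral_mono (integrable_continuousMap _ f) (integrable_of_continuous _ (by fun_prop))
    fun z => h z.1 z.2

lemma le_superhedge (μ : Measure X) (ν : Measure Y) {f : C(X × Y, ℝ)} {a : ℝ}
    (h : ∀ (u : C(X, ℝ)) (v : C(Y, ℝ)), (∀ x y, f (x, y) ≤ u x + v y) →
      a ≤ ∫ x, u x ∂μ + ∫ y, v y ∂ν) : a ≤ superhedge μ ν f := by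
  refine le_csInf ⟨_, ContinuousMap.const X ‖f‖, 0, fun x y => ?_, rfl⟩ ?_
  · simpa using (le_abs_self _).trans (f.norm_coe_le_norm (x, y))
  · rintro _ ⟨u, v, huv, rfl⟩
    exact h u v huv

lemma superhedge_add_le (μ : Measure X) [IsProbabilityMeasure μ] (ν : Measure Y)
    [IsProbabilityMeasure ν] (f g : C(X × Y, ℝ)) :
    superhedge μ ν (f + g) ≤ superhedge μ ν f + superhedge μ ν g := by
  rw [← sub_le_iff_le_add]
  refine le_superhedge μ ν fun u v huv => ?_
  rw [sub_le_iff_le_add', ← sub_le_iff_le_add]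
  refine le_superhedge μ ν fun u' v' huv' => ?_
  have h : superhedge μ ν (f + g) ≤ ∫ x, (u + u') x ∂μ + ∫ y, (v + v') y ∂ν := by
    refine superhedge_le μ ν fun x y => ?_
    have h1 := huv x y
    have h2 := huv' x y
    simp only [ContinuousMap.add_apply]
    linarith
  simp only [ContinuousMap.add_apply] at h
  rw [integral_add (integrable_continuousMap μ u) (integrable_continuousMap μ u'),
    integral_add (integrable_continuousMap ν v) (integrable_continuousMap ν v')] at h
  linarith

lemma superhedge_smul (μ : Measure X) [IsProbabilityMeasure μ] (ν : Measure Y)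
    [IsProbabilityMeasure ν] (t : ℝ) (ht : 0 < t) (f : C(X × Y, ℝ)) :
    superhedge μ ν (t • f) = t * superhedge μ ν f := by
  have key : ∀ s : ℝ, 0 < s → ∀ g : C(X × Y, ℝ),
      superhedge μ ν (s • g) ≤ s * superhedge μ ν g := by
    intro s hs g
    rw [← div_le_iff₀' hs]
    refine le_superhedge μ ν fun u v huv => ?_
    rw [div_le_iff₀' hs]
    have h : superhedge μ ν (s • g) ≤ ∫ x, (s • u) x ∂μ + ∫ y, (s • v) y ∂ν := by
      refine superhedge_le μ ν fun x y => ?_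
      have := mul_le_mul_of_nonneg_left (huv x y) hs.le
      simpa [mul_add] using this
    simpa [integral_const_mul, mul_add] using h
  refine (key t ht f).antisymm ?_
  have h := key t⁻¹ (inv_pos.2 ht) (t • f)
  rwa [smul_smul, inv_mul_cancel₀ ht.ne', one_smul, ← div_eq_inv_mul, le_div_iff₀' ht] at h

/-- The Riesz-Markov-Kakutani theorem on a compact metric space. -/
lemma exists_measure_integral_eq {Z : Type*} [MetricSpace Z] [CompactSpace Z] [MeasurableSpace Z]
    [BorelSpace Z] (L : C(Z, ℝ) →ₗ[ℝ] ℝ) (hL : ∀ f, 0 ≤ f → 0 ≤ L f) :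
    ∃ π : Measure Z, IsFiniteMeasure π ∧ ∀ f : C(Z, ℝ), ∫ z, f z ∂π = L f := by
  let Λ₀ : CompactlySupportedContinuousMap Z ℝ →ₗ[ℝ] ℝ :=
    { toFun := fun f => L f.toContinuousMap
      map_add' := fun f g => L.map_add f.toContinuousMap g.toContinuousMap
      map_smul' := fun t f => L.map_smul t f.toContinuousMap }
  let Λ := PositiveLinearMap.mk₀ Λ₀ fun f hf => hL f.toContinuousMap hf
  refine ⟨RealRMK.rieszMeasure Λ, inferInstance, fun f => ?_⟩
  exact RealRMK.integral_rieszMeasure Λ (CompactlySupportedContinuousMap.continuousMapEquiv f)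

/-- Kantorovich duality: a linear functional below `superhedge` that agrees with it at `-c` is
the integral against an optimal coupling. The bound `D` may be any upper bound of the dual
values. -/
lemma exists_coupling_integral_le (c : C(X × Y, ℝ)) (μ : Measure X) [IsProbabilityMeasure μ]
    (ν : Measure Y) [IsProbabilityMeasure ν] {D : ℝ}
    (hD : ∀ (u : C(X, ℝ)) (v : C(Y, ℝ)), (u, v) ∈ U c → ∫ x, u x ∂μ + ∫ y, v y ∂ν ≤ D) :
    ∃ π ∈ couplings μ ν, ∫ z, c z ∂π ≤ D := by
  obtain ⟨L, hLc, hL⟩ := exists_linearMap_le_sublinear_eq (superhedge μ ν) (superhedge_smul μ ν)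
    (superhedge_add_le μ ν) (-c)
  obtain ⟨π, hfin, hπ⟩ := exists_measure_integral_eq L fun f hf => by
    have h := (hL (-f)).trans (superhedge_le μ ν (u := 0) (v := 0) fun x y => by
      simpa using hf (x, y))
    simpa using h
  -- applied to `(u, v)` and `(-u, -v)`, this inequality fixes the marginals of `π`
  have hle : ∀ (u : C(X, ℝ)) (v : C(Y, ℝ)),
      ∫ z, (u z.1 + v z.2) ∂π ≤ ∫ x, u x ∂μ + ∫ y, v y ∂ν := fun u v => by
    refine (hπ (u.comp ContinuousMap.fst + v.comp ContinuousMap.snd)).trans_le ?_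
    exact (hL _).trans (superhedge_le μ ν fun x y => le_rfl)
  have hfst : π.map Prod.fst = μ := by
    refine ext_of_forall_integral_eq_of_IsFiniteMeasure fun f => ?_
    rw [integral_map measurable_fst.aemeasurable f.continuous.aestronglyMeasurable]
    have h1 := hle f.toContinuousMap 0
    have h2 := hle (-f.toContinuousMap) 0
    simp [integral_neg] at h1 h2
    exact h1.antisymm h2
  have hsnd : π.map Prod.snd = ν := by
    refine ext_of_forall_integral_eq_of_IsFiniteMeasure fun f => ?_
    rw [integral_map measurable_snd.aemeasurable f.continuous.aestronglyMeasurable]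
    have h1 := hle 0 f.toContinuousMap
    have h2 := hle 0 (-f.toContinuousMap)
    simp [integral_neg] at h1 h2
    exact h1.antisymm h2
  refine ⟨π, mem_couplings_iff.2 ⟨hfst, hsnd⟩, ?_⟩
  rw [← neg_le_neg_iff, ← integral_neg]
  refine le_of_le_of_eq ?_ (hLc.symm.trans (hπ (-c)).symm)
  refine le_superhedge μ ν fun u v huv => ?_
  have h := hD (-u) (-v) fun x y => by
    have := huv x y
    simp only [ContinuousMap.neg_apply] at this ⊢
    linarith
  simp only [ContinuousMap.neg_apply, integral_neg] at h
  linarith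

/-! ### Strong duality -/

/-- Strong duality: for `ε > 0` the coupling is the Gibbs measure of the dual solution, and for
`ε = 0` it comes from the Hahn-Banach theorem. -/
lemma SolvesDual.exists_primalObj_le {c : C(X × Y, ℝ)} {ε : ℝ} (hε : 0 ≤ ε) {μ : Measure X}
    [IsProbabilityMeasure μ] {ν : Measure Y} [IsProbabilityMeasure ν]
    {u : C(X, ℝ)} {v : C(Y, ℝ)} (h : SolvesDual c ε μ ν u v) :
    ∃ π ∈ couplings μ ν, primalObj c ε μ ν π ≤ dualObj c ε μ ν u v := by
  rcases hε.eq_or_lt with rfl | hpos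
  · rw [h.dualObj_eq le_rfl]
    obtain ⟨π, hπ, hle⟩ := exists_coupling_integral_le c μ ν
      (D := semiDualObj c 0 μ ν v) fun u' v' huv => by
        rw [← EReal.coe_le_coe_iff, ← h.dualObj_eq le_rfl, ← dualObj_zero_of_mem c μ ν huv]
        exact h u' v'
    exact ⟨π, hπ, by rwa [primalObj_zero, EReal.coe_le_coe_iff]⟩
  · exact ⟨_, gibbs_mem_couplings c hpos h, (primalObj_gibbs c hpos
      (gibbs_mem_couplings c hpos h)).le⟩

lemma SolvesDual.W_eq_dualObj {c : C(X × Y, ℝ)} {ε : ℝ} (hε : 0 ≤ ε) {μ : Measure X}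
    [IsProbabilityMeasure μ] {ν : Measure Y} [IsProbabilityMeasure ν]
    {u : C(X, ℝ)} {v : C(Y, ℝ)} (h : SolvesDual c ε μ ν u v) :
    W c ε μ ν = dualObj c ε μ ν u v := by
  obtain ⟨π, hπ, hle⟩ := h.exists_primalObj_le hε
  refine le_antisymm ((sInf_le (Set.mem_image_of_mem _ hπ)).trans hle) (le_sInf ?_)
  rintro _ ⟨π', hπ', rfl⟩
  exact dualObj_le_primalObj c hε hπ' u v

lemma SolvesDual.solvesPrimal_iff {c : C(X × Y, ℝ)} {ε : ℝ} (hε : 0 < ε) {μ : Measure X}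
    [IsProbabilityMeasure μ] {ν : Measure Y} [IsProbabilityMeasure ν]
    {u : C(X, ℝ)} {v : C(Y, ℝ)} (h : SolvesDual c ε μ ν u v) (π : Measure (X × Y)) :
    SolvesPrimal c ε μ ν π ↔ π = gibbs c ε μ ν u v := by
  have hmem := gibbs_mem_couplings c hε h
  have heq := primalObj_gibbs c hε hmem
  constructor
  · rintro ⟨hπ, hmin⟩
    exact eq_gibbs_of_primalObj_le_dualObj c hε hπ u v ((hmin _ hmem).trans_eq heq)
  · rintro rfl
    exact ⟨hmem, fun π' hπ' => heq.trans_le (dualObj_le_primalObj c hε.le hπ' u v)⟩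

end EntropicOT

theorem proposition2p1 {X Y : Type*} [MetricSpace X] [CompactSpace X]
    [MetricSpace Y] [CompactSpace Y]
    [MeasurableSpace X] [BorelSpace X] [MeasurableSpace Y] [BorelSpace Y]
    (μ : MeasureTheory.Measure X) [MeasureTheory.IsProbabilityMeasure μ]
    (ν : MeasureTheory.Measure Y) [MeasureTheory.IsProbabilityMeasure ν]
    (c : C(X × Y, ℝ)) (ε : ℝ) (hε : 0 ≤ ε) :
    -- the primal problem has a solution
    IsLeast (EntropicOT.primalObj c ε μ ν '' EntropicOT.couplings μ ν) (EntropicOT.W c ε μ ν) ∧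
    -- the dual formulation, with a maximum that is attained
    IsGreatest (Set.range fun p : C(X, ℝ) × C(Y, ℝ) => EntropicOT.dualObj c ε μ ν p.1 p.2)
      (EntropicOT.W c ε μ ν) ∧
    -- the semi-dual formulation, with a maximum that is attained
    IsGreatest (Set.range fun v : C(Y, ℝ) => ((EntropicOT.semiDualObj c ε μ ν v : ℝ) : EReal))
      (EntropicOT.W c ε μ ν) ∧
    -- smoothed `c`-transforms are continuous
    (∀ v : C(Y, ℝ), Continuous (EntropicOT.cTransform c ε ν v)) ∧
    -- recovery of `u` from an optimal `v`
    (∀ v : C(Y, ℝ), EntropicOT.SolvesSemiDual c ε μ ν v →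
      ∃ u : C(X, ℝ), (∀ x, u x = EntropicOT.cTransform c ε ν v x) ∧
        EntropicOT.SolvesDual c ε μ ν u v) ∧
    -- conversely, every dual solution is of this form
    (∀ (u : C(X, ℝ)) (v : C(Y, ℝ)), EntropicOT.SolvesDual c ε μ ν u v →
      EntropicOT.SolvesSemiDual c ε μ ν v ∧
        ∀ᵐ x ∂μ, u x = EntropicOT.cTransform c ε ν v x) ∧
    -- recovery of the primal solution from any dual solution, for `ε > 0`
    (0 < ε → ∀ (u : C(X, ℝ)) (v : C(Y, ℝ)), EntropicOT.SolvesDual c ε μ ν u v →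
      ∀ π : MeasureTheory.Measure (X × Y), EntropicOT.SolvesPrimal c ε μ ν π ↔
        π = (μ.prod ν).withDensity
          (fun z => ENNReal.ofReal (Real.exp ((u z.1 + v z.2 - c z) / ε)))) := by
  open EntropicOT in
  obtain ⟨v, hv⟩ := exists_solvesSemiDual c hε μ ν
  have hdual := solvesDual_cTransformMap c hε μ ν hv
  have hW := hdual.W_eq_dualObj hε
  have hW' := hW.trans (dualObj_cTransformMap c hε μ ν v)
  refine ⟨⟨?_, fun _ => sInf_le⟩, ⟨⟨(cTransformMap c hε ν v, v), hW.symm⟩, ?_⟩,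
    ⟨⟨v, hW'.symm⟩, ?_⟩, continuous_cTransform c hε ν,
    fun w hw => ⟨cTransformMap c hε ν w, fun _ => rfl, solvesDual_cTransformMap c hε μ ν hw⟩,
    fun u w h => ⟨h.solvesSemiDual hε,
      ae_eq_cTransform_of_dualObj_eq c hε μ ν (h.dualObj_eq hε)⟩,
    fun hpos u w h π => h.solvesPrimal_iff hpos π⟩
  · obtain ⟨π, hπ, hle⟩ := hdual.exists_primalObj_le hε
    exact ⟨π, hπ, (hle.trans_eq hW.symm).antisymm (sInf_le (Set.mem_image_of_mem _ hπ))⟩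
  · rintro _ ⟨⟨u', v'⟩, rfl⟩
    exact (hdual u' v').trans_eq hW.symm
  · rintro _ ⟨v', rfl⟩
    exact (EReal.coe_le_coe_iff.2 (hv v')).trans_eq hW'.symm
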